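/- Let $G$ and $H$ be locally compact second countable (Hausdorff) Abelian groups and let $\varphi\colon G\to H$ be a continuous injective homomorphism with $\overline{\varphi(G)}=H$. Let $T=(T_h)_{h\in H}$ be a measure preserving action of $H$ on a standard probability space $(X,\mu)$, that is, a continuous homomorphism $h\mapsto T_h$ from $H$ to the group $\mathrm{Aut}(X,\mu)$ of invertible $\mu$-preserving transformations (modulo equality almost everywhere, with the topology in which $T_n\to T$ if and only if $\mu(T_n^{-1}A\,\triangle\,T^{-1}A)\to 0$ for all measurable $A$). Then the composition $T\circ\varphi=(T_{\varphi(g)})_{g\in G}$ is a measure preserving action of $G$ on $(X,\mu)$, and $$\mathcal M(T\circ\varphi)=\mathcal M(T).$$ Here, for a measure preserving action $S=(S_g)_{g\in G}$ of a locally compact second countable Abelian group $G$ with dual group $\widehat G$, the set $\mathcal M(S)\subset\{1,2,\dots\}\cup\{\infty\}$ is defined as follows. Let $U_S(g)f=f\circ S_{g}^{-1}$ be the Koopman representation on $L^2_0(X,\mu)=L^2(X,\mu)\ominus\mathbb C$, and let $$L^2_0(X,\mu)=\int_{\widehat G}^{\oplus}\mathcal H_\omega\,d\sigma(\omega),\qquad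 U_S(g)=\int_{\widehat G}^{\oplus}\omega(g)I_\omega\,d\sigma(\omega)\quad(g\in G)$$ be its spectral decomposition, where $\sigma$ is a finite Borel measure on $\widehat G$ (a measure of maximal spectral type) and $\omega\mapsto\mathcal H_\omega$ is a measurable field of separable Hilbert spaces that are non-zero for $\sigma$-almost every $\omega$. Then $\mathcal M(S)$ is the set of essential values of the spectral multiplicity function $\omega\mapsto\dim\mathcal H_\omega\in\{1,2,\dots\}\cup\{\infty\}$, i.e. of those $n$ with $\sigma(\{\omega:\dim\mathcal H_\omega=n\})>0$; it does not depend on the choice of the decomposition. -/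

import Mathlib

open MeasureTheory Filter Topology
open scoped ENNReal symmDiff

noncomputable section

/-- The dual group carries its Borel `σ`-algebra. -/
instance PontryaginDual.instMeasurableSpaceBorel (G : Type*) [Monoid G] [TopologicalSpace G] :
    MeasurableSpace (PontryaginDual G) := borel _

instance PontryaginDual.instBorelSpaceBorel (G : Type*) [Monoid G] [TopologicalSpace G] :
    BorelSpace (PontryaginDual G) := ⟨rfl⟩

/-! ### Measurable fields of Hilbert spaces and their direct integrals -/

/-- A measurable field of (separable) Hilbert spaces over a measurable space `Ω`: a Hilbert space
over each point together with a fundamental sequence of sections, whose mutual inner products are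
measurable and whose values span a dense subspace of every fibre. -/
structure MeasurableHilbertField (Ω : Type*) [MeasurableSpace Ω] where
  fiber : Ω → Type
  [normedAddCommGroup : ∀ ω, NormedAddCommGroup (fiber ω)]
  [innerProductSpace : ∀ ω, InnerProductSpace ℂ (fiber ω)]
  [completeSpace : ∀ ω, CompleteSpace (fiber ω)]
  gen : ℕ → ∀ ω, fiber ω
  measurable_gen : ∀ i j, Measurable fun ω => inner ℂ (gen i ω) (gen j ω)
  dense_span_gen : ∀ ω,
    (Submodule.span ℂ (Set.range fun i => gen i ω)).topologicalClosure = ⊤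

namespace MeasurableHilbertField

attribute [instance] normedAddCommGroup innerProductSpace completeSpace

variable {Ω : Type*} [MeasurableSpace Ω] (F : MeasurableHilbertField Ω)

/-- Measurable sections (vector fields) of a measurable field of Hilbert spaces. -/
def IsMeasurableSection (s : ∀ ω, F.fiber ω) : Prop :=
  ∀ i, Measurable fun ω => inner ℂ (F.gen i ω) (s ω)

/-- The measurable sections `s` with `∫ ‖s(ω)‖² dσ(ω) < ∞`; modulo `σ`-almost everywhere equality
these are the vectors of the direct integral of the field. -/
def IsSquareIntegrableSection (σ : Measure Ω) (s : ∀ ω, F.fiber ω) : Prop :=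
  F.IsMeasurableSection s ∧ ∫⁻ ω, ‖s ω‖ₑ ^ 2 ∂σ < ∞

/-- The dimension function `ω ↦ dim H_ω`, with value `⊤` on infinite-dimensional fibres. -/
def dimension (ω : Ω) : ℕ∞ := Cardinal.toENat (Module.rank ℂ (F.fiber ω))

/-- The set of essential values (with respect to `σ`) of the dimension function: the values which
are taken on a set of positive measure. -/
def essentialDimensions (σ : Measure Ω) : Set ℕ∞ := {n | σ {ω | F.dimension ω = n} ≠ 0}

end MeasurableHilbertField

/-- A spectral decomposition of a unitary representation `U` of `G` on `K` is a unitary `V` from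
`K` onto the direct integral over the dual group of a measurable field `F` of non-zero Hilbert
spaces with respect to a finite Borel measure `σ`, which turns every `U g` into the diagonal
operator of multiplication by `ω ↦ ω g`. Then `σ` is a measure of maximal spectral type of `U` and
`F.dimension` is its spectral multiplicity function. The direct integral is described by
representatives: `V f` is a square-integrable section, and equalities of vectors in the direct
integral are equalities of sections almost everywhere. -/
structure IsSpectralDecomposition {G : Type*} [CommGroup G] [TopologicalSpace G]
    {K : Type*} [NormedAddCommGroup K] [InnerProductSpace ℂ K] (U : G →* (K ≃ₗᵢ[ℂ] K))
    (σ : Measure (PontryaginDual G)) (F : MeasurableHilbertField (PontryaginDual G))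
    (V : K → ∀ ω, F.fiber ω) : Prop where
  finite : IsFiniteMeasure σ
  nontrivial : ∀ᵐ ω ∂σ, Nontrivial (F.fiber ω)
  squareIntegrable : ∀ f, F.IsSquareIntegrableSection σ (V f)
  map_add : ∀ f g, ∀ᵐ ω ∂σ, V (f + g) ω = V f ω + V g ω
  map_smul : ∀ (c : ℂ) f, ∀ᵐ ω ∂σ, V (c • f) ω = c • V f ω
  isometry : ∀ f, ∫⁻ ω, ‖V f ω‖ₑ ^ 2 ∂σ = ‖f‖ₑ ^ 2
  surjective : ∀ s, F.IsSquareIntegrableSection σ s → ∃ f, ∀ᵐ ω ∂σ, V f ω = s ω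
  intertwines : ∀ g f, ∀ᵐ ω ∂σ, V (U g f) ω = ((ω g : Circle) : ℂ) • V f ω

/-- The set of essential values of the spectral multiplicity function of a unitary representation.
(A spectral decomposition is unique up to the class of `σ` and an isomorphism of fields, so the
choice of the decomposition is immaterial.) -/
def essentialMultiplicities {G : Type*} [CommGroup G] [TopologicalSpace G]
    {K : Type*} [NormedAddCommGroup K] [InnerProductSpace ℂ K] (U : G →* (K ≃ₗᵢ[ℂ] K)) :
    Set ℕ∞ :=
  {n | ∃ (σ : Measure (PontryaginDual G)) (F : MeasurableHilbertField (PontryaginDual G))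
    (V : K → ∀ ω, F.fiber ω), IsSpectralDecomposition U σ F V ∧ n ∈ F.essentialDimensions σ}

/-! ### Measure-preserving actions and their Koopman representations -/

/-- A measure-preserving action of `G` on `(X, μ)`: a continuous homomorphism `g ↦ T_g` from `G` to
the group `Aut(X, μ)` of invertible measure-preserving transformations, in which transformations
that agree almost everywhere are identified, and whose topology is that of convergence
`μ (T_g⁻¹ A ∆ T_{g₀}⁻¹ A) → 0` for all measurable `A`. Each `T_g` is given by a representative. -/
structure MPAction (G : Type*) [CommGroup G] [TopologicalSpace G] (X : Type*) [MeasurableSpace X]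
    (μ : Measure X) where
  act : G → X → X
  measurePreserving : ∀ g, MeasurePreserving (act g) μ μ
  act_one : act 1 =ᵐ[μ] id
  act_mul : ∀ g h, act (g * h) =ᵐ[μ] act g ∘ act h
  continuous : ∀ A, MeasurableSet A → ∀ g₀,
    Tendsto (fun g => μ ((act g ⁻¹' A) ∆ (act g₀ ⁻¹' A))) (𝓝 g₀) (𝓝 0)

/-- `L²₀(X, μ)`, the orthogonal complement of the constants in `L²(X, μ)`. -/
abbrev LTwoZero {X : Type*} [MeasurableSpace X] (μ : Measure X) [IsProbabilityMeasure μ] :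
    Submodule ℂ (Lp ℂ 2 μ) := (Submodule.span ℂ {Lp.const 2 μ (1 : ℂ)})ᗮ

namespace MPAction

variable {G : Type*} [CommGroup G] [TopologicalSpace G] {X : Type*} [MeasurableSpace X]
  {μ : Measure X} (T : MPAction G X μ)

/-- The isometry `f ↦ f ∘ T_{g⁻¹}` of `L²(X, μ)`. -/
def koopmanL2 (g : G) : Lp ℂ 2 μ →ₗᵢ[ℂ] Lp ℂ 2 μ :=
  Lp.compMeasurePreservingₗᵢ ℂ (T.act g⁻¹) (T.measurePreserving g⁻¹)

theorem koopmanL2_coeFn (g : G) (f : Lp ℂ 2 μ) : T.koopmanL2 g f =ᵐ[μ] f ∘ T.act g⁻¹ :=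
  Lp.coeFn_compMeasurePreserving f (T.measurePreserving g⁻¹)

theorem koopmanL2_one (f : Lp ℂ 2 μ) : T.koopmanL2 1 f = f := by
  apply Lp.ext
  filter_upwards [T.koopmanL2_coeFn 1 f, T.act_one] with x h1 h2
  simp [h1, h2]

theorem koopmanL2_mul (g h : G) (f : Lp ℂ 2 μ) :
    T.koopmanL2 (g * h) f = T.koopmanL2 g (T.koopmanL2 h f) := by
  apply Lp.ext
  have h3 := (T.measurePreserving g⁻¹).quasiMeasurePreserving.ae (T.koopmanL2_coeFn h f)
  filter_upwards [T.koopmanL2_coeFn (g * h) f, T.koopmanL2_coeFn g (T.koopmanL2 h f), h3,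
    T.act_mul h⁻¹ g⁻¹] with x h1 h2 h3 h4
  rw [h1, h2]
  simp only [Function.comp_apply] at h3 h4 ⊢
  rw [h3, mul_inv_rev, h4]

variable [IsProbabilityMeasure μ]

theorem koopmanL2_const (g : G) (c : ℂ) : T.koopmanL2 g (Lp.const 2 μ c) = Lp.const 2 μ c := rfl

theorem koopmanL2_mem (g : G) {f : Lp ℂ 2 μ} (hf : f ∈ LTwoZero μ) :
    T.koopmanL2 g f ∈ LTwoZero μ := by
  rw [Submodule.mem_orthogonal_singleton_iff_inner_right] at hf ⊢
  rw [← T.koopmanL2_const g 1, LinearIsometry.inner_map_map, hf]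

/-- The Koopman operator `U_T(g) f = f ∘ T_{g⁻¹}` on `L²₀(X, μ)`. -/
def koopmanOp (g : G) : LTwoZero μ ≃ₗᵢ[ℂ] LTwoZero μ where
  toFun f := ⟨T.koopmanL2 g f, T.koopmanL2_mem g f.2⟩
  invFun f := ⟨T.koopmanL2 g⁻¹ f, T.koopmanL2_mem g⁻¹ f.2⟩
  map_add' f₁ f₂ := by ext1; simp
  map_smul' c f := by ext1; simp
  left_inv f := by ext1; simp [← koopmanL2_mul, koopmanL2_one]
  right_inv f := by ext1; simp [← koopmanL2_mul, koopmanL2_one]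
  norm_map' f := (T.koopmanL2 g).norm_map f

/-- The Koopman representation of `G` on `L²₀(X, μ)`. -/
def koopman : G →* (LTwoZero μ ≃ₗᵢ[ℂ] LTwoZero μ) where
  toFun := T.koopmanOp
  map_one' := by ext1 f; exact Subtype.ext (T.koopmanL2_one f)
  map_mul' g h := by ext1 f; exact Subtype.ext (T.koopmanL2_mul g h f)

/-- The set of essential spectral multiplicities of an action. -/
def spectralMultiplicities : Set ℕ∞ := essentialMultiplicities T.koopman

end MPAction

end

/-! Density of `φ` makes the dual map `PontryaginDual.map φ` from the characters of `H` to those of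
`G` injective, and σ-compactness of the dual of `H` makes it a Borel embedding. Pushing a spectral
decomposition of `U` forward along it gives one of `U ∘ φ` with the same fibres. The converse needs
the spectral measure of `U ∘ φ` to live on the image of the dual map (`ae_mem_range_map`). For `f`
in `L¹(H)` the operator `U(f) = ∫ f(h) U(h) dh` commutes with the spectral projections, so its norm
bound holds fibrewise. Applied to a translate of `f` minus `f`, this bounds `|ω(g) - 1|
‖V(U(f)v)(ω)‖` by `‖τ f - f‖₁ ‖V v(ω)‖`, where `τ` is translation by `φ g`. Translation is
continuous in `L¹(H)`, so `ω(g) → 1` as `φ(g) → 1`, and `ω` extends to a character of `H`. The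
decomposition then pulls back, and strong continuity identifies the action of all of `H`. -/

noncomputable section

/-! ### Measurability of norms and pull-back of measurable fields -/

namespace MeasurableHilbertField

variable {Ω : Type*} [MeasurableSpace Ω] (F : MeasurableHilbertField Ω)

/-- A countable family of sections, dense in every fibre: the combinations of the generating
sections with coefficients in a countable dense set. -/
def denseSection (n k : ℕ) (ω : Ω) : F.fiber ω :=
  ∑ i : Fin n, TopologicalSpace.denseSeq (Fin n → ℂ) k i • F.gen i ω

theorem dense_denseSection (ω : Ω) :
    Dense (Set.range fun p : ℕ × ℕ => F.denseSection p.1 p.2 ω) := by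
  have h1 : Dense ((Submodule.span ℂ (Set.range fun i => F.gen i ω) : Submodule ℂ _) :
      Set (F.fiber ω)) := by
    rw [Submodule.dense_iff_topologicalClosure_eq_top]
    exact F.dense_span_gen ω
  rw [← dense_closure]
  refine h1.mono fun x hx => ?_
  obtain ⟨n, c, rfl⟩ : ∃ (n : ℕ) (c : Fin n → ℂ), x = ∑ i : Fin n, c i • F.gen i ω := by
    rw [SetLike.mem_coe, Finsupp.mem_span_range_iff_exists_finsupp] at hx
    obtain ⟨c, rfl⟩ := hx
    obtain ⟨n, hn⟩ := c.support.exists_nat_subset_range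
    refine ⟨n, fun i => c i, ?_⟩
    rw [Finsupp.sum_of_support_subset _ hn _ (by simp), Finset.sum_range]
  have hc : Continuous fun d : Fin n → ℂ => ∑ i : Fin n, d i • F.gen i ω := by fun_prop
  have := map_mem_closure hc (TopologicalSpace.denseRange_denseSeq (Fin n → ℂ) c)
    (t := Set.range fun p : ℕ × ℕ => F.denseSection p.1 p.2 ω)
  refine this ?_
  rintro _ ⟨k, rfl⟩
  exact ⟨(n, k), rfl⟩

variable {F}

theorem IsMeasurableSection.inner_sum {s : ∀ ω, F.fiber ω} (hs : F.IsMeasurableSection s)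
    {n : ℕ} (c : Fin n → ℂ) :
    Measurable fun ω => inner ℂ (∑ i : Fin n, c i • F.gen i ω) (s ω) := by
  simp only [sum_inner, inner_smul_left]
  exact Finset.measurable_sum _ fun i _ => (hs i).const_mul _

theorem isMeasurableSection_gen (j : ℕ) : F.IsMeasurableSection (F.gen j) :=
  fun i => F.measurable_gen i j

theorem IsMeasurableSection.sub {s t : ∀ ω, F.fiber ω} (hs : F.IsMeasurableSection s)
    (ht : F.IsMeasurableSection t) : F.IsMeasurableSection fun ω => s ω - t ω := fun i => by
  simp only [inner_sub_right]; exact (hs i).sub (ht i)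

theorem IsMeasurableSection.smul {s : ∀ ω, F.fiber ω} (hs : F.IsMeasurableSection s)
    {c : Ω → ℂ} (hc : Measurable c) : F.IsMeasurableSection fun ω => c ω • s ω := fun i => by
  simp only [inner_smul_right]; exact hc.mul (hs i)

theorem isMeasurableSection_denseSection (n k : ℕ) :
    F.IsMeasurableSection (F.denseSection n k) := fun i => by
  simp only [denseSection, inner_sum, inner_smul_right]
  exact Finset.measurable_sum _ fun j _ => (F.measurable_gen i j).const_mul _

/-- Since `2 Re⟪x, s⟫ - ‖x‖² = ‖s‖² - ‖s - x‖²`, the supremum is approached as `x` nears `s`. Only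
inner products with known sections occur, which makes the norm measurable. -/
theorem enorm_sq_eq_iSup (s : ∀ ω, F.fiber ω) (ω : Ω) : ‖s ω‖ₑ ^ 2 =
    ⨆ p : ℕ × ℕ, ENNReal.ofReal (2 * (inner ℂ (F.denseSection p.1 p.2 ω) (s ω)).re -
      (inner ℂ (F.denseSection p.1 p.2 ω) (F.denseSection p.1 p.2 ω)).re) := by
  have key : ∀ x : F.fiber ω, 2 * (inner ℂ x (s ω)).re - (inner ℂ x x).re =
      ‖s ω‖ ^ 2 - ‖s ω - x‖ ^ 2 := fun x => by
    have h1 := @norm_sub_sq ℂ _ _ _ _ (s ω) x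
    have h2 := inner_re_symm (𝕜 := ℂ) (s ω) x
    have h3 := inner_self_eq_norm_sq (𝕜 := ℂ) x
    simp only [RCLike.re_to_complex] at h1 h2 h3
    rw [h1, h2, h3]; ring
  have hn : ‖s ω‖ₑ ^ 2 = ENNReal.ofReal (‖s ω‖ ^ 2) := by
    rw [ENNReal.ofReal_pow (norm_nonneg _), ofReal_norm]
  simp only [key, hn]
  apply le_antisymm
  · set u := ⨆ p : ℕ × ℕ, ENNReal.ofReal (‖s ω‖ ^ 2 - ‖s ω - F.denseSection p.1 p.2 ω‖ ^ 2)
      with hu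
    have hcl : IsClosed {x : F.fiber ω | ENNReal.ofReal (‖s ω‖ ^ 2 - ‖s ω - x‖ ^ 2) ≤ u} :=
      isClosed_le (ENNReal.continuous_ofReal.comp (by fun_prop)) continuous_const
    have hall : (s ω) ∈ {x : F.fiber ω | ENNReal.ofReal (‖s ω‖ ^ 2 - ‖s ω - x‖ ^ 2) ≤ u} := by
      refine hcl.closure_subset_iff.2 ?_ (F.dense_denseSection ω (s ω))
      rintro _ ⟨p, rfl⟩
      exact le_iSup (fun p : ℕ × ℕ =>
        ENNReal.ofReal (‖s ω‖ ^ 2 - ‖s ω - F.denseSection p.1 p.2 ω‖ ^ 2)) p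
    simpa using hall
  · refine iSup_le fun p => ENNReal.ofReal_le_ofReal ?_
    have := sq_nonneg ‖s ω - F.denseSection p.1 p.2 ω‖
    linarith

theorem IsMeasurableSection.measurable_enorm_sq {s : ∀ ω, F.fiber ω}
    (hs : F.IsMeasurableSection s) : Measurable fun ω => ‖s ω‖ₑ ^ 2 := by
  simp only [enorm_sq_eq_iSup s]
  refine Measurable.iSup fun p => ENNReal.measurable_ofReal.comp (Measurable.sub ?_ ?_)
  · exact (Complex.measurable_re.comp (hs.inner_sum _)).const_mul _
  · exact Complex.measurable_re.comp ((isMeasurableSection_denseSection p.1 p.2).inner_sum _)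

variable (F)

/-- The pull-back of a measurable field of Hilbert spaces along a measurable map. -/
def comap {Ω' : Type*} [MeasurableSpace Ω'] (a : Ω' → Ω) (ha : Measurable a) :
    MeasurableHilbertField Ω' where
  fiber ω := F.fiber (a ω)
  gen i ω := F.gen i (a ω)
  measurable_gen i j := (F.measurable_gen i j).comp ha
  dense_span_gen ω := F.dense_span_gen (a ω)

variable {F}

/-- The fibres over `ω` and `a (b ω)` agree only along an equality of points, so values are cast.
Inner products with the generators survive the cast; off `E` the section is zero. -/
theorem exists_isMeasurableSection_extend {Ω' : Type*} [MeasurableSpace Ω'] {a : Ω' → Ω}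
    (ha : Measurable a) {b : Ω → Ω'} (hb : Measurable b) {E : Set Ω} (hE : MeasurableSet E)
    (hab : ∀ ω ∈ E, a (b ω) = ω) {s' : ∀ ω', (F.comap a ha).fiber ω'}
    (hs' : (F.comap a ha).IsMeasurableSection s') :
    ∃ s : ∀ ω, F.fiber ω, F.IsMeasurableSection s ∧ ∀ ω', b (a ω') = ω' → a ω' ∈ E → s (a ω') = s' ω' := by
  classical
  have cast_inner : ∀ {x y : Ω} (h : x = y) (v : F.fiber x) (i : ℕ),
      inner ℂ (F.gen i y) (h ▸ v : F.fiber y) = inner ℂ (F.gen i x) v := by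
    rintro x y rfl v i; rfl
  have cast_sec : ∀ {x y : Ω'} (h : x = y) (h' : a x = a y),
      (h' ▸ (s' x : F.fiber (a x)) : F.fiber (a y)) = s' y := by
    rintro x y rfl h'; rfl
  refine ⟨fun ω => if h : ω ∈ E then (hab ω h ▸ (s' (b ω) : F.fiber (a (b ω))) : F.fiber ω)
    else 0, fun i => ?_, fun ω' h1 h2 => ?_⟩
  · have : (fun ω => inner ℂ (F.gen i ω) (if h : ω ∈ E then
        (hab ω h ▸ (s' (b ω) : F.fiber (a (b ω))) : F.fiber ω) else 0)) =
        E.indicator fun ω => inner ℂ ((F.comap a ha).gen i (b ω)) (s' (b ω)) := by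
      funext ω
      by_cases h : ω ∈ E
      · simp only [h, dif_pos, Set.indicator_of_mem]
        exact cast_inner (hab ω h) _ i
      · simp [h]
    rw [this]
    exact ((hs' i).comp hb).indicator hE
  · simp only [h2, dif_pos]
    exact cast_sec h1 _

end MeasurableHilbertField

/-- A one-sided inverse becomes two-sided almost everywhere for the pushed measure, which is carried
by points `b ω`. As `p` need not be measurable, its failure set is enlarged to a measurable null
set. -/
theorem ae_map_of_ae_of_rightInverse {Ω Ω' : Type*} [MeasurableSpace Ω] [MeasurableSpace Ω']
    [MeasurableEq Ω'] {σ : Measure Ω} {a : Ω' → Ω} (ha : Measurable a)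
    {b : Ω → Ω'} (hb : Measurable b) (hab : ∀ᵐ ω ∂σ, a (b ω) = ω) {p : Ω → Prop}
    (hp : ∀ᵐ ω ∂σ, p ω) : ∀ᵐ ω' ∂(σ.map b), b (a ω') = ω' ∧ p (a ω') := by
  obtain ⟨N, hN, hNm, hN0⟩ := exists_measurable_superset_of_null hp
  have hm : MeasurableSet {ω' | b (a ω') = ω' ∧ a ω' ∈ Nᶜ} :=
    (measurableSet_eq_fun (hb.comp ha) measurable_id).inter (ha hNm.compl)
  have : ∀ᵐ ω' ∂(σ.map b), b (a ω') = ω' ∧ a ω' ∈ Nᶜ := by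
    rw [ae_map_iff hb.aemeasurable hm]
    filter_upwards [hab, measure_eq_zero_iff_ae_notMem.1 hN0] with ω h1 h2
    rw [h1]
    exact ⟨rfl, h2⟩
  filter_upwards [this] with ω' h
  exact ⟨h.1, by_contra fun h' => h.2 (hN h')⟩

/-! ### Transport of spectral decompositions -/

namespace IsSpectralDecomposition

open MeasurableHilbertField

variable {G : Type*} [CommGroup G] [TopologicalSpace G]
  {K : Type*} [NormedAddCommGroup K] [InnerProductSpace ℂ K] {U : G →* (K ≃ₗᵢ[ℂ] K)}
  {σ : Measure (PontryaginDual G)} {F : MeasurableHilbertField (PontryaginDual G)}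
  {V : K → ∀ ω, F.fiber ω}

theorem isMeasurableSection (h : IsSpectralDecomposition U σ F V) (f : K) :
    F.IsMeasurableSection (V f) := (h.squareIntegrable f).1

theorem map_sub (h : IsSpectralDecomposition U σ F V) (f g : K) :
    ∀ᵐ ω ∂σ, V (f - g) ω = V f ω - V g ω := by
  filter_upwards [h.map_add f ((-1 : ℂ) • g), h.map_smul (-1) g] with ω h1 h2
  rw [show f - g = f + (-1 : ℂ) • g by rw [neg_one_smul, sub_eq_add_neg], h1, h2, neg_one_smul,
    sub_eq_add_neg]

theorem lintegral_sub (h : IsSpectralDecomposition U σ F V) (f g : K) :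
    ∫⁻ ω, ‖V f ω - V g ω‖ₑ ^ 2 ∂σ = ‖f - g‖ₑ ^ 2 := by
  rw [← h.isometry]
  refine lintegral_congr_ae ?_
  filter_upwards [h.map_sub f g] with ω h1
  rw [h1]

theorem eq_of_ae_eq (h : IsSpectralDecomposition U σ F V) {f g : K}
    (hfg : ∀ᵐ ω ∂σ, V f ω = V g ω) : f = g := by
  have h1 : ∫⁻ ω, ‖V f ω - V g ω‖ₑ ^ 2 ∂σ = 0 := by
    rw [← lintegral_zero (μ := σ)]
    refine lintegral_congr_ae ?_
    filter_upwards [hfg] with ω hω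
    simp [hω]
  rw [h.lintegral_sub] at h1
  simpa [sub_eq_zero] using h1

/-- Transport of a spectral decomposition along an almost everywhere invertible measurable map
between dual groups. -/
theorem comap {G' : Type*} [CommGroup G'] [TopologicalSpace G'] {U' : G' →* (K ≃ₗᵢ[ℂ] K)}
    [MeasurableEq (PontryaginDual G')]
    (h : IsSpectralDecomposition U σ F V) {a : PontryaginDual G' → PontryaginDual G}
    (ha : Measurable a) {b : PontryaginDual G → PontryaginDual G'} (hb : Measurable b)
    (hab : ∀ᵐ ω ∂σ, a (b ω) = ω)
    (hU : ∀ g f, ∀ᵐ ω ∂σ, V (U' g f) ω = ((b ω g : Circle) : ℂ) • V f ω) :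
    IsSpectralDecomposition U' (σ.map b) (F.comap a ha) (fun f ω => V f (a ω)) := by
  have hσ := h.finite
  have hae : ∀ {p : PontryaginDual G → Prop}, (∀ᵐ ω ∂σ, p ω) →
      ∀ᵐ ω' ∂(σ.map b), b (a ω') = ω' ∧ p (a ω') :=
    fun hp => ae_map_of_ae_of_rightInverse ha hb hab hp
  have hint : ∀ s, F.IsMeasurableSection s →
      ∫⁻ ω', ‖s (a ω')‖ₑ ^ 2 ∂(σ.map b) = ∫⁻ ω, ‖s ω‖ₑ ^ 2 ∂σ := fun s hs => by
    rw [lintegral_map (f := fun ω' => ‖s (a ω')‖ₑ ^ 2) (hs.measurable_enorm_sq.comp ha) hb]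
    refine lintegral_congr_ae ?_
    filter_upwards [hab] with ω hω
    rw [hω]
  have hiso : ∀ f, ∫⁻ ω', ‖V f (a ω')‖ₑ ^ 2 ∂(σ.map b) = ‖f‖ₑ ^ 2 := fun f => by
    rw [← h.isometry f]
    exact hint _ (h.isMeasurableSection f)
  refine ⟨inferInstance, ?_, fun f => ⟨fun i => (h.isMeasurableSection f i).comp ha, ?_⟩,
    fun f g => ?_, fun c f => ?_, hiso, fun s' hs' => ?_, fun g f => ?_⟩
  · filter_upwards [hae h.nontrivial] with ω hω using hω.2
  · exact (hiso f).trans_lt (by simp)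
  · filter_upwards [hae (h.map_add f g)] with ω hω using hω.2
  · filter_upwards [hae (h.map_smul c f)] with ω hω using hω.2
  -- Surjectivity: the given section is carried back along `b`, off a null set, and realised by a
  -- vector there.
  · obtain ⟨N, hN, hNm, hN0⟩ := exists_measurable_superset_of_null hab
    obtain ⟨s, hs, hss⟩ := exists_isMeasurableSection_extend ha hb hNm.compl
      (fun ω hω => by_contra fun h' => hω (hN h')) hs'.1
    have hNE : ∀ᵐ ω ∂σ, ω ∈ Nᶜ := measure_eq_zero_iff_ae_notMem.1 hN0
    obtain ⟨f, hf⟩ := h.surjective s ⟨hs, by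
      rw [← hint s hs]
      refine lt_of_le_of_lt (lintegral_mono_ae ?_) hs'.2
      filter_upwards [hae hNE] with ω' hω'
      rw [hss ω' hω'.1 hω'.2]
      exact le_rfl⟩
    refine ⟨f, ?_⟩
    filter_upwards [hae hf, hae hNE] with ω' h1 h2
    rw [h1.2, hss ω' h2.1 h2.2]
  · filter_upwards [hae (hU g f)] with ω hω
    rw [hω.2, hω.1]; rfl

/-- The fibre over `b ω` is the one over `a (b ω) = ω`. One inclusion suffices, because transport is
used in both directions. -/
theorem essentialDimensions_comap {Ω Ω' : Type*} [MeasurableSpace Ω] [MeasurableSpace Ω']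
    [MeasurableEq Ω'] {σ : Measure Ω} {a : Ω' → Ω} (ha : Measurable a)
    {b : Ω → Ω'} (hb : Measurable b) (hab : ∀ᵐ ω ∂σ, a (b ω) = ω)
    (F : MeasurableHilbertField Ω) :
    F.essentialDimensions σ ⊆ (F.comap a ha).essentialDimensions (σ.map b) := by
  intro n hn h0
  refine hn ?_
  have h1 := ae_of_ae_map hb.aemeasurable (measure_eq_zero_iff_ae_notMem.1 h0)
  refine measure_eq_zero_iff_ae_notMem.2 ?_
  filter_upwards [h1, hab] with ω h2 h3 h4
  refine h2 ?_
  change F.dimension (a (b ω)) = n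
  rw [h3]; exact h4

end IsSpectralDecomposition

/-! ### The dual homomorphism -/

instance PontryaginDual.instSecondCountableTopology {G : Type*} [CommGroup G] [TopologicalSpace G]
    [LocallyCompactSpace G] [SecondCountableTopology G] :
    SecondCountableTopology (PontryaginDual G) :=
  (ContinuousMonoidHom.isInducing_toContinuousMap G Circle).secondCountableTopology

/-- On each compact piece of a countable cover `f` is a closed embedding, so images of Borel sets
are countable unions of Borel sets. -/
theorem Continuous.measurableEmbedding_of_sigmaCompactSpace {α β : Type*} [TopologicalSpace α]
    [SigmaCompactSpace α] [MeasurableSpace α] [BorelSpace α] [TopologicalSpace β]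
    [T2Space β] [MeasurableSpace β] [BorelSpace β] {f : α → β} (hf : Continuous f)
    (hinj : Function.Injective f) : MeasurableEmbedding f := by
  refine ⟨hinj, hf.measurable, fun {s} hs => ?_⟩
  have : f '' s = ⋃ n, (fun x : compactCovering α n => f x) '' (Subtype.val ⁻¹' s) := by
    ext y
    simp only [Set.mem_image, Set.mem_iUnion, Set.mem_preimage, Subtype.exists, exists_and_left]
    constructor
    · rintro ⟨x, hx, rfl⟩
      have := iUnion_compactCovering α ▸ Set.mem_univ x
      obtain ⟨n, hn⟩ := Set.mem_iUnion.1 this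
      exact ⟨n, x, hx, hn, rfl⟩
    · rintro ⟨n, x, hx, hn, rfl⟩
      exact ⟨x, hx, rfl⟩
  rw [this]
  refine MeasurableSet.iUnion fun n => ?_
  have : CompactSpace (compactCovering α n) :=
    isCompact_iff_compactSpace.1 (isCompact_compactCovering α n)
  have he := (hf.comp continuous_subtype_val).isClosedEmbedding
    (hinj.comp (Subtype.val_injective (p := fun x => x ∈ compactCovering α n)))
  exact he.measurableEmbedding.measurableSet_image' (measurable_subtype_coe hs)

theorem PontryaginDual.map_injective {G H : Type*} [CommGroup G] [TopologicalSpace G] [CommGroup H]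
    [TopologicalSpace H] {φ : G →ₜ* H} (hφ : DenseRange φ) :
    Function.Injective (PontryaginDual.map φ) := fun χ ψ h => by
  refine DFunLike.coe_injective (hφ.equalizer (map_continuous χ) (map_continuous ψ) ?_)
  funext g
  exact DFunLike.congr_fun h g

theorem PontryaginDual.measurableEmbedding_map {G H : Type*} [CommGroup G] [TopologicalSpace G]
    [CommGroup H] [TopologicalSpace H] [IsTopologicalGroup H] [LocallyCompactSpace H]
    [SecondCountableTopology H] {φ : G →ₜ* H} (hφ : DenseRange φ) :
    MeasurableEmbedding (PontryaginDual.map φ) :=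
  Continuous.measurableEmbedding_of_sigmaCompactSpace (map_continuous (PontryaginDual.map φ))
    (map_injective hφ)

/-! ### Integrated representations -/

namespace UnitaryRepresentation

variable {H : Type*} [CommGroup H] [MeasurableSpace H]
  {K : Type*} [NormedAddCommGroup K] [InnerProductSpace ℂ K]
  (U : H →* (K ≃ₗᵢ[ℂ] K)) (ν : Measure H)

/-- The operator `∫ f(h) U(h) dν(h)` of the integrated representation. -/
def integrated (f : Lp ℂ 1 ν) (v : K) : K := ∫ h, f h • U h v ∂ν

variable {U ν}

theorem norm_integrated_le (f : Lp ℂ 1 ν) (v : K) : ‖integrated U ν f v‖ ≤ ‖f‖ * ‖v‖ := by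
  refine (norm_integral_le_integral_norm _).trans_eq ?_
  simp [norm_smul, L1.norm_eq_integral_norm, integral_mul_const]

variable [TopologicalSpace H] [BorelSpace H]

/-- Approximate identity: `f` is the normalised indicator of a compact neighbourhood of `1` on which
`U` moves `v` by at most `ε`. -/
theorem exists_norm_integrated_sub_le [IsTopologicalGroup H] [LocallyCompactSpace H] [T2Space H]
    [CompleteSpace K]
    [ν.IsOpenPosMeasure] [IsFiniteMeasureOnCompacts ν]
    (hU : ∀ v, Continuous fun h => U h v) (v : K) {ε : ℝ} (hε : 0 < ε) :
    ∃ f : Lp ℂ 1 ν, ‖integrated U ν f v - v‖ ≤ ε := by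
  have hnhds : {h | ‖U h v - v‖ ≤ ε} ∈ 𝓝 (1 : H) := by
    have : Tendsto (fun h => ‖U h v - v‖) (𝓝 1) (𝓝 0) := by
      have := (((hU v).sub continuous_const).norm : Continuous fun h => ‖U h v - v‖).tendsto 1
      simpa using this
    filter_upwards [this.eventually (gt_mem_nhds hε)] with h hh using le_of_lt hh
  obtain ⟨C, hC1, hCs, hCc⟩ := local_compact_nhds hnhds
  have hCm : MeasurableSet C := hCc.isClosed.measurableSet
  have hfin : ν C ≠ ∞ := hCc.measure_lt_top.ne
  have hpos : 0 < ν.real C :=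
    ENNReal.toReal_pos (MeasureTheory.Measure.measure_pos_of_mem_nhds ν hC1).ne' hfin
  set c : ℂ := (((ν.real C)⁻¹ : ℝ) : ℂ) with hc
  refine ⟨indicatorConstLp 1 hCm hfin c, ?_⟩
  have h1 : integrated U ν (indicatorConstLp 1 hCm hfin c) v = ∫ h in C, c • U h v ∂ν := by
    rw [integrated, ← integral_indicator hCm]
    refine integral_congr_ae ?_
    filter_upwards [indicatorConstLp_coeFn (p := 1) (hs := hCm) (hμs := hfin) (c := c)] with h hh
    rw [hh]
    by_cases hm : h ∈ C <;> simp [hm]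
  have h2 : v = ∫ _ in C, c • v ∂ν := by
    rw [setIntegral_const, hc, Complex.coe_smul, smul_smul, mul_inv_cancel₀ hpos.ne', one_smul]
  have hint : IntegrableOn (fun h => c • U h v) C ν :=
    ((hU v).const_smul c).continuousOn.integrableOn_compact hCc
  have h3 : integrated U ν (indicatorConstLp 1 hCm hfin c) v - v =
      ∫ h in C, (c • U h v - c • v) ∂ν := by
    rw [integral_sub hint (integrableOn_const hfin), ← h1, ← h2]
  rw [h3]
  refine (norm_setIntegral_le_of_norm_le_const (C := (ν.real C)⁻¹ * ε) hCc.measure_lt_top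
    fun h hh => ?_).trans_eq ?_
  · rw [← smul_sub, norm_smul, hc, Complex.norm_real, Real.norm_of_nonneg (by positivity)]
    have : ‖U h v - v‖ ≤ ε := hCs hh
    gcongr
  · field_simp

variable [SecondCountableTopology H]

theorem integrable_smul (hU : ∀ v, Continuous fun h => U h v) (f : Lp ℂ 1 ν) (v : K) :
    Integrable (fun h => f h • U h v) ν := by
  refine ((L1.integrable_coeFn f).norm.mul_const ‖v‖).mono'
    ((Lp.aestronglyMeasurable f).smul (hU v).aestronglyMeasurable) ?_
  exact .of_forall fun h => by simp [norm_smul]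

theorem integrated_sub (hU : ∀ v, Continuous fun h => U h v) (f g : Lp ℂ 1 ν) (v : K) :
    integrated U ν (f - g) v = integrated U ν f v - integrated U ν g v := by
  rw [integrated, integrated, integrated,
    ← integral_sub (integrable_smul hU f v) (integrable_smul hU g v)]
  refine integral_congr_ae ?_
  filter_upwards [Lp.coeFn_sub f g] with h hh
  rw [hh, Pi.sub_apply, sub_smul]

variable [CompleteSpace K]

theorem integrated_comm (hU : ∀ v, Continuous fun h => U h v) {P : K →L[ℂ] K}
    (hP : ∀ h v, P (U h v) = U h (P v)) (f : Lp ℂ 1 ν) (v : K) :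
    P (integrated U ν f v) = integrated U ν f (P v) := by
  rw [integrated, ← P.integral_comp_comm (integrable_smul hU f v)]
  simp [integrated, hP]

/-- Left invariance of `ν` moves `h₀` onto `f`; the translate is `h ↦ f (h₀⁻¹ * h)`. -/
theorem apply_integrated [IsTopologicalGroup H] [ν.IsMulLeftInvariant] (hU : ∀ v, Continuous fun h => U h v)
    (h₀ : H) (f : Lp ℂ 1 ν) (v : K) :
    U h₀ (integrated U ν f v) = integrated U ν (DomMulAct.mk h₀⁻¹ • f) v := by
  have h1 : U h₀ (integrated U ν f v) = ∫ h, f h • U (h₀ * h) v ∂ν := by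
    have := ((U h₀ : K ≃ₗᵢ[ℂ] K).toContinuousLinearEquiv : K →L[ℂ] K).integral_comp_comm
      (integrable_smul hU f v)
    rw [integrated]
    refine this.symm.trans ?_
    simp
  rw [h1, integrated, ← integral_mul_left_eq_self _ h₀⁻¹]
  refine integral_congr_ae ?_
  filter_upwards [DomMulAct.smul_Lp_ae_eq (DomMulAct.mk h₀⁻¹) f] with h hh
  rw [hh]
  simp

end UnitaryRepresentation

/-! ### Extension of characters from a dense subgroup -/

/-- Continuity at `1` for the topology induced by `φ` makes `χ` uniformly continuous, so it extends
by completeness of the circle. -/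
theorem DenseRange.exists_extend_character {G H : Type*} [CommGroup G] [CommGroup H]
    [TopologicalSpace H] [IsTopologicalGroup H] {φ : G →* H} (hφ : DenseRange φ)
    {χ : G →* Circle} (hχ : Tendsto χ (comap φ (𝓝 1)) (𝓝 1)) :
    ∃ ψ : H →ₜ* Circle, ∀ g, ψ (φ g) = χ g := by
  let _ : TopologicalSpace G := .induced φ inferInstance
  have di : IsDenseInducing φ := ⟨⟨rfl⟩, hφ⟩
  have hlim : ∀ b, ∃ c, Tendsto χ (comap φ (𝓝 b)) (𝓝 c) := fun b => by
    have hne : NeBot (comap φ (𝓝 b)) := di.comap_nhds_neBot b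
    have hc : Cauchy (map χ (comap φ (𝓝 b))) := by
      refine cauchy_map_iff.2 ⟨hne, ?_⟩
      -- Quotients of points near `b` are near `1`, so the image filter is Cauchy.
      have h1 : Tendsto (fun p : G × G => p.2 / p.1) (comap φ (𝓝 b) ×ˢ comap φ (𝓝 b))
          (comap φ (𝓝 1)) := by
        rw [tendsto_comap_iff]
        have h' := (tendsto_comap.comp tendsto_snd :
          Tendsto (φ ∘ Prod.snd) (comap φ (𝓝 b) ×ˢ comap φ (𝓝 b)) (𝓝 b)).div'
          (tendsto_comap.comp tendsto_fst)
        rw [div_self'] at h'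
        exact h'.congr fun p => by simp
      rw [uniformity_eq_comap_nhds_one, tendsto_comap_iff]
      exact (hχ.comp h1).congr fun p => by simp
    exact CompleteSpace.complete hc
  have hcont := di.continuous_extend hlim
  have hext : ∀ g, di.extend χ (φ g) = χ g := di.extend_eq' hlim
  refine ⟨⟨MonoidHom.mk' (di.extend χ) fun a b => ?_, hcont⟩, hext⟩
  refine hφ.induction_on₂ (p := fun a b => di.extend χ (a * b) = di.extend χ a * di.extend χ b)
    (isClosed_eq (hcont.comp continuous_mul) ?_) (fun g g' => ?_) a b
  · exact (hcont.comp continuous_fst).mul (hcont.comp continuous_snd)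
  · rw [← _root_.map_mul, hext, hext, hext, _root_.map_mul]

namespace MeasurableHilbertField

variable {Ω : Type*} [MeasurableSpace Ω] {F : MeasurableHilbertField Ω}

theorem exists_gen_ne_zero (ω : Ω) [Nontrivial (F.fiber ω)] : ∃ i, F.gen i ω ≠ 0 := by
  by_contra! h
  obtain ⟨x, hx⟩ := exists_ne (0 : F.fiber ω)
  have h1 := F.dense_span_gen ω
  have h2 : Submodule.span ℂ (Set.range fun i => F.gen i ω) = ⊥ := by
    rw [Submodule.span_eq_bot]
    rintro _ ⟨i, rfl⟩
    exact h i
  rw [h2, IsClosed.submodule_topologicalClosure_eq (by simp)] at h1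
  have : x ∈ (⊥ : Submodule ℂ (F.fiber ω)) := h1 ▸ Submodule.mem_top
  exact hx (by simpa using this)

variable (F) in
/-- The generating sections, rescaled so as to be bounded. -/
def boundedGen (i : ℕ) (ω : Ω) : F.fiber ω :=
  (1 + inner ℂ (F.gen i ω) (F.gen i ω))⁻¹ • F.gen i ω

theorem norm_boundedGen (i : ℕ) (ω : Ω) :
    ‖F.boundedGen i ω‖ = ‖F.gen i ω‖ / (1 + ‖F.gen i ω‖ ^ 2) := by
  have : (1 + inner ℂ (F.gen i ω) (F.gen i ω) : ℂ) = ((1 + ‖F.gen i ω‖ ^ 2 : ℝ) : ℂ) := by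
    rw [inner_self_eq_norm_sq_to_K]; simp
  rw [boundedGen, norm_smul, this, norm_inv, Complex.norm_real,
    Real.norm_of_nonneg (by positivity)]
  field_simp

theorem isSquareIntegrableSection_boundedGen {σ : Measure Ω} [IsFiniteMeasure σ] (i : ℕ) :
    F.IsSquareIntegrableSection σ (F.boundedGen i) := by
  refine ⟨(isMeasurableSection_gen i).smul ((F.measurable_gen i i).const_add 1).inv, ?_⟩
  refine (lintegral_mono (g := fun _ => 1) fun ω => ?_).trans_lt (by simp)
  refine pow_le_one₀ zero_le ?_
  have : ‖F.boundedGen i ω‖ ≤ 1 := by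
    rw [norm_boundedGen, div_le_one (by positivity)]
    nlinarith [sq_nonneg (‖F.gen i ω‖ - 1)]
  rw [← ofReal_norm]
  exact ENNReal.ofReal_le_one.2 this

theorem boundedGen_ne_zero {i : ℕ} {ω : Ω} (h : F.gen i ω ≠ 0) : F.boundedGen i ω ≠ 0 := by
  rw [← norm_pos_iff] at h ⊢
  rw [norm_boundedGen]
  positivity

end MeasurableHilbertField

/-! ### Spectral projections and limits of diagonal operators -/

namespace IsSpectralDecomposition

open MeasurableHilbertField UnitaryRepresentation

variable {G : Type*} [CommGroup G] [TopologicalSpace G]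
  {K : Type*} [NormedAddCommGroup K] [InnerProductSpace ℂ K] {U : G →* (K ≃ₗᵢ[ℂ] K)}
  {σ : Measure (PontryaginDual G)} {F : MeasurableHilbertField (PontryaginDual G)}
  {V : K → ∀ ω, F.fiber ω}

/-- Countably many vectors detect almost every fibre, so the exceptional null sets can later be
united. -/
theorem exists_seq_ne_zero (h : IsSpectralDecomposition U σ F V) :
    ∃ v : ℕ → K, ∀ᵐ ω ∂σ, ∃ i, V (v i) ω ≠ 0 := by
  have := h.finite
  choose v hv using fun i => h.surjective _ (isSquareIntegrableSection_boundedGen i)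
  refine ⟨v, ?_⟩
  filter_upwards [h.nontrivial, ae_all_iff.2 hv] with ω h1 h2
  obtain ⟨i, hi⟩ := exists_gen_ne_zero (F := F) ω
  exact ⟨i, by rw [h2]; exact boundedGen_ne_zero hi⟩

/-- The spectral projection of a Borel subset of the dual group. -/
theorem exists_projection (h : IsSpectralDecomposition U σ F V) {E : Set (PontryaginDual G)}
    (hE : MeasurableSet E) :
    ∃ P : K →L[ℂ] K, ∀ v, ∀ᵐ ω ∂σ, V (P v) ω = E.indicator (1 : PontryaginDual G → ℂ) ω • V v ω := by
  have hle : ∀ v, ∫⁻ ω, ‖E.indicator (1 : PontryaginDual G → ℂ) ω • V v ω‖ₑ ^ 2 ∂σ ≤ ‖v‖ₑ ^ 2 := fun v => by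
    rw [← h.isometry v]
    refine lintegral_mono fun ω => ?_
    by_cases hω : ω ∈ E <;> simp [hω]
  choose P hP using fun v => h.surjective (fun ω => E.indicator (1 : PontryaginDual G → ℂ) ω • V v ω)
    ⟨(h.isMeasurableSection v).smul (measurable_one.indicator hE), (hle v).trans_lt (by simp)⟩
  refine ⟨LinearMap.mkContinuous ⟨⟨P, fun v w => h.eq_of_ae_eq ?_⟩, fun c v => h.eq_of_ae_eq ?_⟩
    1 fun v => ?_, hP⟩
  · filter_upwards [hP (v + w), hP v, hP w, h.map_add v w, h.map_add (P v) (P w)]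
      with ω h1 h2 h3 h4 h5
    rw [h1, h5, h2, h3, h4, smul_add]
  · filter_upwards [hP (c • v), hP v, h.map_smul c v, h.map_smul c (P v)] with ω h1 h2 h3 h4
    rw [h1, RingHom.id_apply, h4, h2, h3, smul_comm]
  · have h1 : ‖P v‖ₑ ^ 2 ≤ ‖v‖ₑ ^ 2 := by
      rw [← h.isometry (P v)]
      refine (lintegral_congr_ae ?_).trans_le (hle v)
      filter_upwards [hP v] with ω h1
      rw [h1]
    rw [one_mul]
    have h2 := (ENNReal.pow_le_pow_left_iff two_ne_zero).1 h1
    exact enorm_le_iff_norm_le.1 h2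

theorem setLIntegral_eq (h : IsSpectralDecomposition U σ F V) {E : Set (PontryaginDual G)}
    (hE : MeasurableSet E) {P : K →L[ℂ] K}
    (hP : ∀ v, ∀ᵐ ω ∂σ, V (P v) ω = E.indicator (1 : PontryaginDual G → ℂ) ω • V v ω) (v : K) :
    ∫⁻ ω in E, ‖V v ω‖ₑ ^ 2 ∂σ = ‖P v‖ₑ ^ 2 := by
  rw [← h.isometry (P v), ← lintegral_indicator hE]
  refine lintegral_congr_ae ?_
  filter_upwards [hP v] with ω h1
  rw [h1]
  by_cases hω : ω ∈ E <;> simp [hω]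

theorem projection_comm (h : IsSpectralDecomposition U σ F V) {E : Set (PontryaginDual G)}
    {P : K →L[ℂ] K}
    (hP : ∀ v, ∀ᵐ ω ∂σ, V (P v) ω = E.indicator (1 : PontryaginDual G → ℂ) ω • V v ω) (g : G) (v : K) :
    P (U g v) = U g (P v) := by
  refine h.eq_of_ae_eq ?_
  filter_upwards [hP (U g v), h.intertwines g v, hP v, h.intertwines g (P v)] with ω h1 h2 h3 h4
  rw [h1, h2, h4, h3, smul_comm]

/-- On the set where all `V (w n)` vanish, the integral of `‖V v‖²` is at most `‖v - w n‖²` for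
every `n`. -/
theorem ae_ne_zero_of_tendsto (h : IsSpectralDecomposition U σ F V) {v : K} {w : ℕ → K}
    (hw : Tendsto w atTop (𝓝 v)) : ∀ᵐ ω ∂σ, V v ω ≠ 0 → ∃ n, V (w n) ω ≠ 0 := by
  have hm : ∀ u, Measurable fun ω => ‖V u ω‖ₑ ^ 2 := fun u =>
    (h.isMeasurableSection u).measurable_enorm_sq
  set E := {ω | ∀ n, ‖V (w n) ω‖ₑ ^ 2 = 0} with hEdef
  have hE : MeasurableSet E := by
    rw [hEdef, Set.ofPred_forall]
    exact MeasurableSet.iInter fun n => hm (w n) (measurableSet_singleton 0)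
  have hle : ∀ n, ∫⁻ ω in E, ‖V v ω‖ₑ ^ 2 ∂σ ≤ ‖v - w n‖ₑ ^ 2 := fun n => by
    rw [← h.lintegral_sub]
    refine le_trans (setLIntegral_mono_ae' hE (.of_forall fun ω hω => ?_))
      (setLIntegral_le_lintegral E _)
    have : V (w n) ω = 0 := by simpa using hω n
    rw [this, sub_zero]
  have hlim : Tendsto (fun n => ‖v - w n‖ₑ ^ 2) atTop (𝓝 0) := by
    have h1 : Tendsto (fun n => v - w n) atTop (𝓝 0) := by
      simpa using hw.const_sub v
    have h2 := (((ENNReal.continuous_pow 2).comp continuous_enorm).tendsto (0 : K)).comp h1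
    simpa [Function.comp_def] using h2
  have h0 : ∫⁻ ω in E, ‖V v ω‖ₑ ^ 2 ∂σ = 0 :=
    le_antisymm (ge_of_tendsto' hlim hle) zero_le
  rw [setLIntegral_eq_zero_iff hE (hm v)] at h0
  filter_upwards [h0] with ω hω hv
  by_contra! hn
  exact hv (by simpa using hω fun n => by simp [hn n])

/-- A unitary that is a limit of diagonal operators is diagonal. -/
theorem ae_eq_smul_of_tendsto (h : IsSpectralDecomposition U σ F V) {f : K} {u : K} {g : ℕ → G}
    (hu : Tendsto (fun n => U (g n) f) atTop (𝓝 u)) :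
    ∀ᵐ ω ∂σ, ∀ z : ℂ, Tendsto (fun n => ((ω (g n) : Circle) : ℂ)) atTop (𝓝 z) →
      V u ω = z • V f ω := by
  have hm : ∀ n, Measurable fun ω => ‖V (U (g n) f) ω - V u ω‖ₑ ^ 2 := fun n =>
    ((h.isMeasurableSection _).sub (h.isMeasurableSection _)).measurable_enorm_sq
  -- Fatou's lemma replaces the passage to an almost everywhere convergent subsequence.
  have h0 : ∫⁻ ω, liminf (fun n => ‖V (U (g n) f) ω - V u ω‖ₑ ^ 2) atTop ∂σ = 0 := by
    refine le_antisymm ((lintegral_liminf_le hm).trans_eq ?_) zero_le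
    refine Tendsto.liminf_eq ?_
    simp only [h.lintegral_sub]
    have h1 : Tendsto (fun n => U (g n) f - u) atTop (𝓝 0) := by
      simpa using hu.sub_const u
    have h2 := (((ENNReal.continuous_pow 2).comp continuous_enorm).tendsto (0 : K)).comp h1
    simpa [Function.comp_def] using h2
  rw [lintegral_eq_zero_iff (.liminf hm)] at h0
  filter_upwards [h0, ae_all_iff.2 fun n => h.intertwines (g n) f] with ω h1 h2 z hz
  have h3 : Tendsto (fun n => ‖V (U (g n) f) ω - V u ω‖ₑ ^ 2) atTop
      (𝓝 (‖z • V f ω - V u ω‖ₑ ^ 2)) := by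
    simp only [h2]
    exact (((ENNReal.continuous_pow 2).comp continuous_enorm).tendsto _).comp ((hz.smul_const _).sub_const _)
  have h4 : ‖z • V f ω - V u ω‖ₑ ^ 2 = 0 := h3.liminf_eq.symm.trans h1
  have h5 : z • V f ω - V u ω = 0 := by simpa using h4
  exact (sub_eq_zero.1 h5).symm

end IsSpectralDecomposition

theorem Circle.isInducing_coe : Topology.IsInducing fun z : Circle => (z : ℂ) :=
  Topology.IsInducing.subtypeVal

/-! ### The spectral measure is carried by characters that extend to `H` -/

namespace IsSpectralDecomposition

open MeasurableHilbertField UnitaryRepresentation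

variable {G H : Type*} [CommGroup G] [TopologicalSpace G]
  [CommGroup H] [TopologicalSpace H]
  {K : Type*} [NormedAddCommGroup K] [InnerProductSpace ℂ K]
  {U : H →* (K ≃ₗᵢ[ℂ] K)} {φ : G →ₜ* H}
  {σ : Measure (PontryaginDual G)} {F : MeasurableHilbertField (PontryaginDual G)}
  {V : K → ∀ ω, F.fiber ω}

theorem ae_eq_smul_of_map_eq [FirstCountableTopology H]
    (h : IsSpectralDecomposition (U.comp (φ : G →* H)) σ F V)
    (hU : ∀ v, Continuous fun h => U h v) (hφ : DenseRange φ) (x : H) (f : K) :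
    ∀ᵐ ω ∂σ, ∀ χ : PontryaginDual H, PontryaginDual.map φ χ = ω →
      V (U x f) ω = ((χ x : Circle) : ℂ) • V f ω := by
  obtain ⟨y, hy, hyx⟩ := mem_closure_iff_seq_limit.1 (hφ x)
  choose g hg using hy
  have hu : Tendsto (fun n => U.comp (φ : G →* H) (g n) f) atTop (𝓝 (U x f)) := by
    refine (((hU f).tendsto x).comp hyx).congr fun n => ?_
    simp [← hg n]
  filter_upwards [h.ae_eq_smul_of_tendsto hu] with ω hω χ hχ
  refine hω _ ?_
  have h1 := (((Circle.isInducing_coe.continuous.comp (map_continuous χ)).tendsto x).comp hyx)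
  refine h1.congr fun n => ?_
  simp [← hχ, hg n]

variable [CompleteSpace K] [SecondCountableTopology H]

/-- Commuting with the projection `P` of any Borel set `E` turns the operator bound at `P v` into a
comparison of integrals over `E`; since `E` is arbitrary, it holds pointwise. -/
theorem ae_norm_integrated_le [MeasurableSpace H] [BorelSpace H] {ν : Measure H}
    (h : IsSpectralDecomposition (U.comp (φ : G →* H)) σ F V)
    (hU : ∀ v, Continuous fun h => U h v) (hφ : DenseRange φ) (f : Lp ℂ 1 ν) (v : K) :
    ∀ᵐ ω ∂σ, ‖V (integrated U ν f v) ω‖ ≤ ‖f‖ * ‖V v ω‖ := by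
  have hfin := h.finite
  have h1 : (fun ω => ‖V (integrated U ν f v) ω‖ₑ ^ 2) ≤ᵐ[σ]
      fun ω => ‖f‖ₑ ^ 2 * ‖V v ω‖ₑ ^ 2 := by
    refine ae_le_of_forall_setLIntegral_le_of_sigmaFinite
      (h.isMeasurableSection _).measurable_enorm_sq fun E hE _ => ?_
    obtain ⟨P, hP⟩ := h.exists_projection hE
    have hcomm : ∀ x w, P (U x w) = U x (P w) := fun x w => by
      refine congr_fun (hφ.equalizer (P.continuous.comp (hU w)) (hU (P w)) ?_) x
      funext g
      exact h.projection_comm hP g w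
    rw [lintegral_const_mul _ (h.isMeasurableSection _).measurable_enorm_sq,
      h.setLIntegral_eq hE hP, h.setLIntegral_eq hE hP, integrated_comm hU hcomm, ← mul_pow]
    gcongr
    rw [← ofReal_norm, ← ofReal_norm, ← ofReal_norm, ← ENNReal.ofReal_mul (norm_nonneg _)]
    exact ENNReal.ofReal_le_ofReal (norm_integrated_le f (P v))
  filter_upwards [h1] with ω hω
  rw [← mul_pow, ENNReal.pow_le_pow_left_iff two_ne_zero, ← ofReal_norm, ← ofReal_norm,
    ← ofReal_norm, ← ENNReal.ofReal_mul (norm_nonneg _)] at hω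
  exact (ENNReal.ofReal_le_ofReal_iff (by positivity)).1 hω

theorem ae_norm_sub_one_mul_le [IsTopologicalGroup H] [MeasurableSpace H] [BorelSpace H] {ν : Measure H}
    [ν.IsMulLeftInvariant]
    (h : IsSpectralDecomposition (U.comp (φ : G →* H)) σ F V)
    (hU : ∀ v, Continuous fun h => U h v) (hφ : DenseRange φ) (f : Lp ℂ 1 ν) (v : K) (g : G) :
    ∀ᵐ ω ∂σ, ‖((ω g : Circle) : ℂ) - 1‖ * ‖V (integrated U ν f v) ω‖ ≤
      ‖DomMulAct.mk (φ g)⁻¹ • f - f‖ * ‖V v ω‖ := by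
  filter_upwards [h.ae_norm_integrated_le hU hφ (DomMulAct.mk (φ g)⁻¹ • f - f) v,
    h.intertwines g (integrated U ν f v),
    h.map_sub (U (φ g) (integrated U ν f v)) (integrated U ν f v)] with ω h1 h2 h3
  have h2' : V (U (φ g) (integrated U ν f v)) ω =
    ((ω g : Circle) : ℂ) • V (integrated U ν f v) ω := h2
  rw [integrated_sub hU, ← apply_integrated hU, h3, h2'] at h1
  rwa [← norm_smul, sub_smul, one_smul]

/-- At almost every `ω` some `U(f)v` from a countable family has a non-zero component, and dividing
by its norm bounds `|ω(g) - 1|` by a quantity tending to `0` as `φ(g) → 1`. -/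
theorem ae_mem_range_map [IsTopologicalGroup H] [LocallyCompactSpace H] [T2Space H] [SecondCountableTopology G]
    (h : IsSpectralDecomposition (U.comp (φ : G →* H)) σ F V)
    (hU : ∀ v, Continuous fun h => U h v) (hφ : DenseRange φ) :
    ∀ᵐ ω ∂σ, ω ∈ Set.range (PontryaginDual.map φ) := by
  borelize H
  set ν : Measure H := Measure.haar
  have : Fact ((1 : ℝ≥0∞) ≠ ∞) := ⟨ENNReal.one_ne_top⟩
  obtain ⟨v, hv⟩ := h.exists_seq_ne_zero
  choose f hf using fun i (n : ℕ) => exists_norm_integrated_sub_le (ν := ν) hU (v i)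
    (Nat.one_div_pos_of_nat (α := ℝ) (n := n))
  have hlim : ∀ i, Tendsto (fun n => integrated U ν (f i n) (v i)) atTop (𝓝 (v i)) := fun i =>
    tendsto_iff_norm_sub_tendsto_zero.2 <| squeeze_zero (fun _ => norm_nonneg _) (hf i)
      tendsto_one_div_add_atTop_nhds_zero_nat
  -- The null set depends on `g`, so `g` runs over a dense sequence; continuity of `ω` restores all
  -- `g` in `h4`.
  have hbound := fun i n m => h.ae_norm_sub_one_mul_le hU hφ (f i n) (v i)
    (TopologicalSpace.denseSeq G m)
  filter_upwards [hv, ae_all_iff.2 fun i => h.ae_ne_zero_of_tendsto (hlim i),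
    ae_all_iff.2 fun i => ae_all_iff.2 fun n => ae_all_iff.2 (hbound i n)] with ω h1 h2 h3
  obtain ⟨i, hi⟩ := h1
  obtain ⟨n, hn⟩ := h2 i hi
  set w := V (integrated U ν (f i n) (v i)) ω
  have hw : 0 < ‖w‖ := norm_pos_iff.2 hn
  have htrans : Continuous fun x : H => ‖DomMulAct.mk x⁻¹ • f i n - f i n‖ := by
    have : Continuous fun x : H => DomMulAct.mk x⁻¹ • f i n :=
      (DomMulAct.continuous_mk.comp continuous_inv).smul continuous_const
    fun_prop
  have h4 : ∀ g, ‖((ω g : Circle) : ℂ) - 1‖ * ‖w‖ ≤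
      ‖DomMulAct.mk (φ g)⁻¹ • f i n - f i n‖ * ‖V (v i) ω‖ := by
    have hcl : IsClosed {g | ‖((ω g : Circle) : ℂ) - 1‖ * ‖w‖ ≤
        ‖DomMulAct.mk (φ g)⁻¹ • f i n - f i n‖ * ‖V (v i) ω‖} := by
      refine isClosed_le ?_ ((htrans.comp (map_continuous φ)).mul continuous_const)
      exact (((Circle.isInducing_coe.continuous.comp (map_continuous ω)).sub continuous_const).norm).mul
        continuous_const
    intro g
    refine hcl.closure_subset_iff.2 ?_ (TopologicalSpace.denseRange_denseSeq G g)
    rintro _ ⟨m, rfl⟩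
    exact h3 i n m
  have h5 : Tendsto (fun g => ((ω g : Circle) : ℂ)) (Filter.comap φ (𝓝 1)) (𝓝 1) := by
    rw [tendsto_iff_norm_sub_tendsto_zero]
    refine squeeze_zero (fun _ => norm_nonneg _) (fun g => (le_div_iff₀ hw).2 (h4 g)) ?_
    have h6 := ((htrans.mul continuous_const).div_const ‖w‖ : Continuous fun x : H =>
      ‖DomMulAct.mk x⁻¹ • f i n - f i n‖ * ‖V (v i) ω‖ / ‖w‖).tendsto 1
    have h7 := h6.comp (tendsto_comap (f := φ))
    simpa [Function.comp_def] using h7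
  have h8 : Tendsto ω (Filter.comap φ (𝓝 1)) (𝓝 1) := by
    rw [Topology.IsInducing.tendsto_nhds_iff Circle.isInducing_coe]
    simpa [Function.comp_def] using h5
  obtain ⟨ψ, hψ⟩ := DenseRange.exists_extend_character (φ := (φ : G →* H)) hφ
    (χ := (ContinuousMonoidHom.toMonoidHom ω : G →* Circle)) h8
  exact ⟨ψ, PontryaginDual.ext fun g => hψ g⟩

end IsSpectralDecomposition

/-! ### Equality of multiplicities and application to Koopman representations -/

theorem essentialMultiplicities_comp {G H : Type*} [CommGroup G] [TopologicalSpace G]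
    [LocallyCompactSpace G] [SecondCountableTopology G]
    [CommGroup H] [TopologicalSpace H] [IsTopologicalGroup H] [T2Space H]
    [LocallyCompactSpace H] [SecondCountableTopology H]
    {K : Type*} [NormedAddCommGroup K] [InnerProductSpace ℂ K] [CompleteSpace K]
    {U : H →* (K ≃ₗᵢ[ℂ] K)} (hU : ∀ v, Continuous fun h => U h v)
    {φ : G →ₜ* H} (hφ : DenseRange φ) :
    essentialMultiplicities (U.comp (φ : G →* H)) = essentialMultiplicities U := by
  have hι := PontryaginDual.measurableEmbedding_map hφ
  -- `r` is a Borel left inverse of the dual map; on the range it is also a right inverse.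
  obtain ⟨r, hr, hrι⟩ := hι.exists_measurable_extend measurable_id fun _ => ⟨1⟩
  replace hrι : ∀ χ, r (PontryaginDual.map φ χ) = χ := congr_fun hrι
  ext n
  constructor
  · rintro ⟨σ, F, V, h, hn⟩
    have hιr : ∀ᵐ ω ∂σ, PontryaginDual.map φ (r ω) = ω := by
      filter_upwards [h.ae_mem_range_map hU hφ] with ω hω
      obtain ⟨χ, rfl⟩ := hω
      rw [hrι]
    refine ⟨_, _, _, h.comap hι.measurable hr hιr fun x f => ?_,
      IsSpectralDecomposition.essentialDimensions_comap hι.measurable hr hιr F hn⟩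
    filter_upwards [h.ae_eq_smul_of_map_eq hU hφ x f, hιr] with ω h1 h2
    exact h1 _ h2
  · rintro ⟨σ, F, V, h, hn⟩
    have hrι' : ∀ᵐ χ ∂σ, r (PontryaginDual.map φ χ) = χ := .of_forall hrι
    exact ⟨_, _, _, h.comap hr hι.measurable hrι' fun g f => h.intertwines (φ g) f,
      IsSpectralDecomposition.essentialDimensions_comap hr hι.measurable hrι' F hn⟩

namespace MPAction

variable {H : Type*} [CommGroup H] [TopologicalSpace H] {X : Type*} [MeasurableSpace X]
  {μ : Measure X} (T : MPAction H X μ)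

/-- The operators are isometries, so simple functions suffice; on indicators this is the topology of
`Aut(X, μ)`. -/
theorem continuous_koopmanL2 [IsTopologicalGroup H] (f : Lp ℂ 2 μ) :
    Continuous fun h => T.koopmanL2 h f := by
  suffices hc : Continuous fun p : Lp ℂ 2 μ × H => T.koopmanL2 p.2 p.1 from
    hc.comp (continuous_const.prodMk continuous_id)
  refine continuous_prod_of_dense_continuous_lipschitzWith _ 1
    (Lp.simpleFunc.dense (by simp)) ?_ fun h => (T.koopmanL2 h).isometry.lipschitz
  intro f hf
  lift f to Lp.simpleFunc ℂ 2 μ using hf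
  induction f using Lp.simpleFunc.induction two_ne_zero ENNReal.ofNat_ne_top with
  | add hfp hgp _ ihf ihg =>
    simp only [AddSubgroup.coe_add, map_add]
    exact ihf.add ihg
  | @indicatorConst c s hs hμs =>
    have h1 : ∀ h, T.koopmanL2 h (Lp.simpleFunc.indicatorConst 2 hs hμs.ne c : Lp ℂ 2 μ) =
        indicatorConstLp 2 ((T.measurePreserving h⁻¹).measurable hs)
          (by rw [(T.measurePreserving h⁻¹).measure_preimage hs.nullMeasurableSet]
              exact hμs.ne) c := fun h => by
      rw [Lp.simpleFunc.coe_indicatorConst]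
      exact Lp.indicatorConstLp_compMeasurePreserving hs hμs.ne c (T.measurePreserving h⁻¹)
    simp only [h1]
    refine continuous_indicatorConstLp_set (by simp) fun h => ?_
    exact (T.continuous s hs h⁻¹).comp (continuous_inv.tendsto h)

variable [IsProbabilityMeasure μ]

theorem continuous_koopman [IsTopologicalGroup H] (f : LTwoZero μ) :
    Continuous fun h => T.koopman h f :=
  (T.continuous_koopmanL2 (f : Lp ℂ 2 μ)).subtype_mk _

/-- The composition of an action with a continuous homomorphism. -/
def compHom {G : Type*} [CommGroup G] [TopologicalSpace G] (φ : G →ₜ* H) : MPAction G X μ where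
  act g := T.act (φ g)
  measurePreserving g := T.measurePreserving (φ g)
  act_one := by simpa using T.act_one
  act_mul g h := by simpa using T.act_mul (φ g) (φ h)
  continuous A hA g₀ := (T.continuous A hA (φ g₀)).comp ((map_continuous φ).tendsto g₀)

theorem koopman_compHom {G : Type*} [CommGroup G] [TopologicalSpace G] (φ : G →ₜ* H) :
    (T.compHom φ).koopman = T.koopman.comp (φ : G →* H) := by
  ext g f : 2
  refine Subtype.ext (Lp.ext ?_)
  have h1 := (T.compHom φ).koopmanL2_coeFn g f
  have h2 := T.koopmanL2_coeFn (φ g) f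
  rw [← map_inv φ g] at h2
  exact h1.trans h2.symm

end MPAction

end

theorem mainTheorem6 {G H : Type*}
    [CommGroup G] [TopologicalSpace G] [IsTopologicalGroup G] [T2Space G]
    [LocallyCompactSpace G] [SecondCountableTopology G]
    [CommGroup H] [TopologicalSpace H] [IsTopologicalGroup H] [T2Space H]
    [LocallyCompactSpace H] [SecondCountableTopology H]
    (φ : G →ₜ* H) (hφ : Function.Injective φ) (hdense : DenseRange φ)
    {X : Type*} [MeasurableSpace X] [StandardBorelSpace X]
    (μ : Measure X) [IsProbabilityMeasure μ] (T : MPAction H X μ) :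
    ∃ S : MPAction G X μ, (∀ g, S.act g = T.act (φ g)) ∧
      S.spectralMultiplicities = T.spectralMultiplicities := by
  refine ⟨T.compHom φ, fun g => rfl, ?_⟩
  rw [MPAction.spectralMultiplicities, MPAction.koopman_compHom]
  exact essentialMultiplicities_comp T.continuous_koopman hdense
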